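/- Let $d\ge 2$ and $n\ge 0$ be integers, $\mathcal{A}_d=\{0,\dots,d-1\}$, $\omega=e^{2\pi i/d}$, and for $x,y\in\mathcal{A}_d$ let $$|\phi_x^y\rangle=\frac1{\sqrt d}\sum_{a=0}^{d-1}\omega^{ay}\,|a,\;a+x \bmod d\rangle$$ be the $d$-dimensional Bell states. For a word $i=(i_1,\dots,i_n)$ of pairs $i_j=\binom{y_j}{x_j}\in\mathcal{A}_d\times\mathcal{A}_d$ put $|\phi_i\rangle=|\phi_{x_1}^{y_1}\rangle\otimes\cdots\otimes|\phi_{x_n}^{y_n}\rangle$, a vector of the registers $A,B$ of $n$ qudits each, and let $\#_\alpha^\beta(i)$ be the number of $j$ with $x_j=\alpha$ and $y_j=\beta$. Let $\lambda_\alpha^\beta$ ($\alpha,\beta\in\mathcal{A}_d$) be nonnegative integers and let $J=\{i:\#_\alpha^\beta(i)=\lambda_\alpha^\beta\text{ for all }\alpha,\beta\in\mathcal{A}_d\}$. Let $$|\psi\rangle_{ABE}=\sum_{i\in J}\alpha_i\,|\phi_i\rangle_{AB}\,|E_i\rangle_E$$ be a unit vector, where $\alpha_i\in\mathbb{C}$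 and the $|E_i\rangle$ are arbitrary vectors of a finite-dimensional Hilbert space $E$. Measure the registers $A$ and $B$ of $|\psi\rangle$ in the computational basis, which gives the state $\rho_{A_ZB_ZE}$, and let $\rho_{A_ZE}=\mathrm{tr}_{B_Z}\,\rho_{A_ZB_ZE}$. Then $$H_\infty(A_Z|E)_\rho\;\ge\; n\log_2 d-\frac1{\log_d 2}\sum_{\alpha=0}^{d-1}n_\alpha\,h_d\!\left(\frac1{n_\alpha}\sum_{\beta=1}^{d-1}\lambda_\alpha^\beta\right),\qquad n_\alpha=\sum_{\beta=0}^{d-1}\lambda_\alpha^\beta,$$ where terms with $n_\alpha=0$ are read as $0$. Here $h_d(x)=x\log_d(d-1)-x\log_d x-(1-x)\log_d(1-x)$ on $[0,1]$ (with $0\log 0=0$) is the $d$-ary entropy function, and $H_\infty(A|E)_\rho=\sup_{\sigma_E}\bigl(-\log_2\min\{t:\rho_{AE}\le t\,(1_A\otimes\sigma_E)\}\bigr)$, the supremum being over the density operators $\sigma_E$ on $E$ (with the value $-\infty$ for a $\sigma_E$ that admits no such $t$), is the conditional quantum min-entropy. -/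

import Mathlib

open scoped Kronecker ComplexOrder

noncomputable section

namespace HDBell

/-- A word over the alphabet of pairs `(y, x)`, `x, y ∈ {0, …, d-1}`: the first component of each
letter is its phase `y`, the second one its bit `x`. -/
abbrev Word (d n : ℕ) : Type := Fin n → Fin d × Fin d

/-- Labels of the computational basis of `n` qudits. -/
abbrev Dits (d n : ℕ) : Type := Fin n → Fin d

/-- The phase string of a word. -/
def ph {d n : ℕ} (k : Word d n) : Dits d n := fun j => (k j).1

/-- The bit string of a word. -/
def bt {d n : ℕ} (k : Word d n) : Dits d n := fun j => (k j).2

/-- The number of positions of `k` with bit value `α` and phase value `β`. -/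
def typeCount {d n : ℕ} (α β : Fin d) (k : Word d n) : ℕ :=
  (Finset.univ.filter fun j : Fin n => bt k j = α ∧ ph k j = β).card

/-- The words with exactly `lam α β` positions of bit value `α` and phase value `β`,
for all `α`, `β`. -/
def typeClass {d : ℕ} (n : ℕ) (lam : Fin d → Fin d → ℕ) : Finset (Word d n) :=
  Finset.univ.filter fun k => ∀ α β : Fin d, typeCount α β k = lam α β

/-- The root of unity `exp (2 π i / d)`. -/
def rootOfUnity (d : ℕ) : ℂ := Complex.exp (2 * Real.pi * Complex.I / d)

/-- The amplitude `⟨a, b | φ_x^y⟩` of the Bell state `φ_x^y = d^{-1/2} ∑_a ω^{a y} |a, a + x⟩`.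
Addition in `Fin d` is addition modulo `d`. -/
def bellAmp {d : ℕ} (x y a b : Fin d) : ℂ :=
  if b = a + x then ((1 / Real.sqrt d : ℝ) : ℂ) * rootOfUnity d ^ (a.val * y.val) else 0

/-- The amplitude `⟨a, b | φ_k⟩` of the `n`-fold tensor product
`φ_k = φ_{k_1} ⊗ ⋯ ⊗ φ_{k_n}` of Bell states. -/
def bellWord {d n : ℕ} (k : Word d n) (ab : Dits d n × Dits d n) : ℂ :=
  ∏ j : Fin n, bellAmp (bt k j) (ph k j) (ab.1 j) (ab.2 j)

/-- The vector `∑_{k ∈ J} c_k |φ_k⟩_{AB} ⊗ |E_k⟩_E`, in the computational basis of the registers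
`A`, `B` and an orthonormal basis of `E` labelled by `ε`. -/
def bellSuperposition {d n : ℕ} {ε : Type*} (J : Finset (Word d n)) (c : Word d n → ℂ)
    (eve : Word d n → ε → ℂ) : (Dits d n × Dits d n) × ε → ℂ :=
  fun p => ∑ k ∈ J, c k * bellWord k p.1 * eve k p.2

/-- The rank-one operator `|ψ⟩⟨ψ|`. -/
def ketbra {X : Type*} (ψ : X → ℂ) : Matrix X X ℂ := Matrix.vecMulVec ψ (star ψ)

/-- Density operators: positive semidefinite, of trace one. -/
def IsDensity {X : Type*} [Fintype X] (ρ : Matrix X X ℂ) : Prop :=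
  ρ.PosSemidef ∧ ρ.trace = 1

/-- Measurement of the register `X` in the computational basis, the outcome being kept in the
register `X`: `ρ ↦ ∑_x (|x⟩⟨x| ⊗ 1) ρ (|x⟩⟨x| ⊗ 1)`. -/
def measureFst {X ε : Type*} [Fintype X] [DecidableEq X] [Fintype ε] [DecidableEq ε]
    (ρ : Matrix (X × ε) (X × ε) ℂ) : Matrix (X × ε) (X × ε) ℂ :=
  ∑ x : X, (Matrix.single x x (1 : ℂ) ⊗ₖ (1 : Matrix ε ε ℂ)) * ρ *
    (Matrix.single x x (1 : ℂ) ⊗ₖ (1 : Matrix ε ε ℂ))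

/-- Partial trace over the register `B`. -/
def traceB {A B ε : Type*} [Fintype B] (ρ : Matrix ((A × B) × ε) ((A × B) × ε) ℂ) :
    Matrix (A × ε) (A × ε) ℂ :=
  Matrix.of fun p q => ∑ b : B, ρ ((p.1, b), p.2) ((q.1, b), q.2)

/-- The min-entropy of `ρ_{AE}` relative to `σ_E`: `-log₂` of the least `t` with
`ρ_{AE} ≤ t • (1_A ⊗ σ_E)`, and `-∞` if there is no such `t`. -/
def minEntropyRel {A ε : Type*} [DecidableEq A]
    (ρ : Matrix (A × ε) (A × ε) ℂ) (σ : Matrix ε ε ℂ) : EReal :=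
  ⨆ (t : ℝ) (_ : 0 < t)
    (_ : ((t : ℂ) • ((1 : Matrix A A ℂ) ⊗ₖ σ) - ρ).PosSemidef), ((-Real.logb 2 t : ℝ) : EReal)

/-- The conditional quantum min-entropy `H_∞(A|E)_ρ`: the supremum of the min-entropies of `ρ_{AE}`
relative to `σ_E`, over all density operators `σ_E`. -/
def minEntropy {A ε : Type*} [DecidableEq A] [Fintype ε]
    (ρ : Matrix (A × ε) (A × ε) ℂ) : EReal :=
  ⨆ (σ : Matrix ε ε ℂ) (_ : IsDensity σ), minEntropyRel ρ σ

/-- The `d`-ary entropy function (with `0 log 0 = 0`). -/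
def daryEntropy (d : ℕ) (x : ℝ) : ℝ :=
  x * Real.logb d ((d : ℝ) - 1) - x * Real.logb d x - (1 - x) * Real.logb d (1 - x)

/-- The number of positions of bit value `α`. -/
def bitCount {d : ℕ} (lam : Fin d → Fin d → ℕ) (α : Fin d) : ℕ := ∑ β : Fin d, lam α β

/-- The number of positions of bit value `α` and nonzero phase value. -/
def phaseErrorCount {d : ℕ} (lam : Fin d → Fin d → ℕ) (α : Fin d) : ℕ :=
  ∑ β ∈ Finset.univ.filter (fun β : Fin d => 1 ≤ β.val), lam α β

end HDBell

end

/-!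
Write `e_{a,b}` for the unnormalised state of `E` after the outcomes `a`, `b`. The amplitude of the
Bell word `k` at `(a, b)` has modulus `d ^ (-n/2)` if `b - a` is the bit string of `k`, and vanishes
otherwise (`norm_bellWord_sq`). Hence `e_{a,b}` only involves the words of the type class whose bit
string is `b - a`, and if there are at most `M` of these for each bit string, the Cauchy–Schwarz
inequality gives `∑_b |e_{a,b}⟩⟨e_{a,b}| ≤ (M / d ^ n) σ` for every `a`, where
`σ = ∑_k |c_k E_k⟩⟨c_k E_k|` (`sum_norm_sum_bellWord_sq_le`). The Bell words being orthonormal, `σ`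
is a density operator (`isDensity_wordMixture`). So the min-entropy is at least `n log₂ d - log₂ M`
(`le_minEntropy_bellSuperposition`).

It remains to take `M = 2 ^ S`, where `S` is the entropy term of the claim
(`card_typeClass_filter_bt_le`). Given a bit string, draw the phases independently: at a position of
bit value `α` the phase is `0` with probability `1 - p_α` and is otherwise uniform, where `p_α` is
the proportion of nonzero phases prescribed by the type. Every phase string that completes the bit
string to a word of the type class then has the probability `2 ^ (-S)`, and these probabilities add
up to at most `1`.
-/

namespace HDBell

/-! ### Orthonormality of the Bell states -/

lemma isPrimitiveRoot_rootOfUnity {d : ℕ} (hd : d ≠ 0) : IsPrimitiveRoot (rootOfUnity d) d :=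
  Complex.isPrimitiveRoot_exp d hd

lemma norm_rootOfUnity {d : ℕ} (hd : d ≠ 0) : ‖rootOfUnity d‖ = 1 :=
  (isPrimitiveRoot_rootOfUnity hd).norm'_eq_one hd

lemma rootOfUnity_mul_star {d : ℕ} (hd : d ≠ 0) : rootOfUnity d * star (rootOfUnity d) = 1 := by
  rw [Complex.star_def, Complex.mul_conj, Complex.normSq_eq_norm_sq, norm_rootOfUnity hd]
  simp

lemma sum_rootOfUnity_pow_mul_star {d : ℕ} (hd : d ≠ 0) (y y' : Fin d) :
    ∑ a : Fin d, rootOfUnity d ^ (a.val * y.val) * star (rootOfUnity d ^ (a.val * y'.val)) =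
      if y = y' then (d : ℂ) else 0 := by
  have hω := isPrimitiveRoot_rootOfUnity hd
  set ω := rootOfUnity d with hωdef
  have h1 : ω * star ω = 1 := rootOfUnity_mul_star hd
  set z : ℂ := ω ^ y.val * star ω ^ y'.val with hz
  have hterm : ∀ a : Fin d, ω ^ (a.val * y.val) * star (ω ^ (a.val * y'.val)) = z ^ a.val := by
    intro a
    rw [hz, mul_pow, star_pow, ← pow_mul, ← pow_mul, mul_comm y.val, mul_comm y'.val]
  simp_rw [hterm]
  split_ifs with h
  · subst h
    have : z = 1 := by rw [hz, ← mul_pow, h1, one_pow]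
    simp [this]
  · have hz1 : z ≠ 1 := by
      intro hz1
      apply h
      apply Fin.ext
      apply hω.pow_inj y.2 y'.2
      calc ω ^ y.val = z * ω ^ y'.val := by
            rw [hz, mul_assoc, ← mul_pow, mul_comm (star ω), h1, one_pow, mul_one]
        _ = ω ^ y'.val := by rw [hz1, one_mul]
    have hzd : z ^ d = 1 := by
      rw [hz, mul_pow, ← pow_mul, ← pow_mul, mul_comm y.val, mul_comm y'.val, pow_mul, pow_mul,
        ← star_pow, hω.pow_eq_one]
      simp
    rw [Fin.sum_univ_eq_sum_range (fun a => z ^ a) d]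
    have := geom_sum_mul z d
    rw [hzd, sub_self] at this
    exact (mul_eq_zero.mp this).resolve_right (sub_ne_zero.mpr hz1)

lemma norm_bellAmp_sq {d : ℕ} (hd : d ≠ 0) (x y a b : Fin d) :
    ‖bellAmp x y a b‖ ^ 2 = if b = a + x then (d : ℝ)⁻¹ else 0 := by
  unfold bellAmp
  split_ifs
  · rw [norm_mul, norm_pow, norm_rootOfUnity hd, one_pow, mul_one, Complex.norm_real,
      Real.norm_eq_abs, sq_abs, div_pow, Real.sq_sqrt (Nat.cast_nonneg d)]
    simp
  · simp

lemma sum_bellAmp_mul_star {d : ℕ} (hd : d ≠ 0) (x y x' y' : Fin d) :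
    ∑ ab : Fin d × Fin d, bellAmp x y ab.1 ab.2 * star (bellAmp x' y' ab.1 ab.2) =
      if y = y' ∧ x = x' then 1 else 0 := by
  have : NeZero d := ⟨hd⟩
  rw [Fintype.sum_prod_type]
  by_cases hx : x = x'
  · subst hx
    have hinner : ∀ a : Fin d, ∑ b : Fin d, bellAmp x y a b * star (bellAmp x y' a b) =
        (d : ℂ)⁻¹ *
          (rootOfUnity d ^ (a.val * y.val) * star (rootOfUnity d ^ (a.val * y'.val))) := by
      intro a
      rw [Finset.sum_eq_single (a + x) (by
        intro b _ hb
        simp [bellAmp, hb]) (by simp)]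
      have hs : ((1 / Real.sqrt d : ℝ) : ℂ) * ((1 / Real.sqrt d : ℝ) : ℂ) = (d : ℂ)⁻¹ := by
        rw [← Complex.ofReal_mul, div_mul_div_comm, Real.mul_self_sqrt (Nat.cast_nonneg d)]
        simp
      simp only [bellAmp, if_true, star_mul', Complex.star_def, Complex.conj_ofReal]
      rw [← hs]
      ring
    simp_rw [hinner]
    rw [← Finset.mul_sum, sum_rootOfUnity_pow_mul_star hd]
    simp [hd]
  · rw [if_neg (fun h => hx h.2)]
    refine Finset.sum_eq_zero fun a _ => Finset.sum_eq_zero fun b _ => ?_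
    unfold bellAmp
    by_cases hb : b = a + x
    · have : b ≠ a + x' := fun hb' => hx (add_left_cancel (hb.symm.trans hb'))
      simp [this]
    · simp [hb]

lemma sum_bellWord_mul_star {d n : ℕ} (hd : d ≠ 0) (k l : Word d n) :
    ∑ ab : Dits d n × Dits d n, bellWord k ab * star (bellWord l ab) =
      if k = l then 1 else 0 := by
  have hprod : ∑ ab : Dits d n × Dits d n, bellWord k ab * star (bellWord l ab) =
      ∏ j : Fin n, ∑ ab : Fin d × Fin d,
        bellAmp (bt k j) (ph k j) ab.1 ab.2 * star (bellAmp (bt l j) (ph l j) ab.1 ab.2) := by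
    rw [Fintype.prod_sum]
    refine (Fintype.sum_equiv
      (Equiv.arrowProdEquivProdArrow (Fin n) (fun _ => Fin d) (fun _ => Fin d))
      _ _ fun f => ?_).symm
    simp only [bellWord, star_prod, ← Finset.prod_mul_distrib]
    rfl
  rw [hprod]
  simp_rw [sum_bellAmp_mul_star hd, Finset.prod_ite_zero]
  simp [funext_iff, Prod.ext_iff, ph, bt]

/-- Parseval's identity for the Bell words. -/
lemma sum_norm_sum_bellWord_sq {d n : ℕ} (hd : d ≠ 0) (J : Finset (Word d n)) (f : Word d n → ℂ) :
    ∑ ab : Dits d n × Dits d n, ‖∑ k ∈ J, f k * bellWord k ab‖ ^ 2 = ∑ k ∈ J, ‖f k‖ ^ 2 := by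
  have key : ∀ z : ℂ, ((‖z‖ ^ 2 : ℝ) : ℂ) = z * star z := fun z => by
    rw [Complex.star_def, Complex.mul_conj, Complex.normSq_eq_norm_sq]
  apply Complex.ofReal_injective
  rw [Complex.ofReal_sum, Complex.ofReal_sum]
  simp_rw [key, star_sum, Finset.sum_mul_sum]
  rw [Finset.sum_comm]
  refine Finset.sum_congr rfl fun k hk => ?_
  rw [Finset.sum_comm]
  have : ∀ l, ∑ ab : Dits d n × Dits d n, f k * bellWord k ab * star (f l * bellWord l ab) =
      if k = l then f k * star (f l) else 0 := by
    intro l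
    have h := sum_bellWord_mul_star hd k l
    calc _ = f k * star (f l) *
          ∑ ab : Dits d n × Dits d n, bellWord k ab * star (bellWord l ab) := by
          rw [Finset.mul_sum]
          refine Finset.sum_congr rfl fun ab _ => ?_
          rw [star_mul']
          ring
      _ = _ := by rw [h]; split_ifs <;> simp
  simp_rw [this]
  simp [hk]

lemma norm_bellWord_sq {d n : ℕ} (hd : d ≠ 0) (k : Word d n) (a b : Dits d n) :
    ‖bellWord k (a, b)‖ ^ 2 = if b = a + bt k then ((d : ℝ) ^ n)⁻¹ else 0 := by
  unfold bellWord
  rw [norm_prod, ← Finset.prod_pow]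
  simp_rw [norm_bellAmp_sq hd, Finset.prod_ite_zero]
  simp [funext_iff]

/-! ### Words of a given type and a given bit string -/

/-- The relative frequency of nonzero phases among the positions of bit value `α`; it is `0` if
there is no such position. -/
noncomputable def phaseErrorRate {d : ℕ} (lam : Fin d → Fin d → ℕ) (α : Fin d) : ℝ :=
  1 / (bitCount lam α : ℝ) * (phaseErrorCount lam α : ℝ)

/-- The probability of the phase `β` at a position of bit value `α`, when a phase error occurs at
the rate prescribed by `lam` and all nonzero phases are equally likely. -/
noncomputable def phaseProb {d : ℕ} (lam : Fin d → Fin d → ℕ) (α β : Fin d) : ℝ :=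
  if 1 ≤ β.val then phaseErrorRate lam α / ((d : ℝ) - 1) else 1 - phaseErrorRate lam α

/-- The exponent `(1 / log_d 2) ∑_α n_α h_d(p_α)`: the number of bits that suffices to describe
the phase string of a word of type `lam` when its bit string is known. -/
noncomputable def phaseEntropy {d : ℕ} (lam : Fin d → Fin d → ℕ) : ℝ :=
  1 / Real.logb d 2 * ∑ α : Fin d, (bitCount lam α : ℝ) *
    daryEntropy d (phaseErrorRate lam α)

section Count
variable {d : ℕ} (lam : Fin d → Fin d → ℕ)

lemma phaseErrorCount_le_bitCount (α : Fin d) : phaseErrorCount lam α ≤ bitCount lam α :=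
  Finset.sum_le_sum_of_subset (Finset.filter_subset _ _)

lemma bitCount_mul_phaseErrorRate (α : Fin d) :
    (bitCount lam α : ℝ) * phaseErrorRate lam α = phaseErrorCount lam α := by
  rcases Nat.eq_zero_or_pos (bitCount lam α) with h | h
  · have := phaseErrorCount_le_bitCount lam α
    simp [h, show phaseErrorCount lam α = 0 by omega]
  · have : (bitCount lam α : ℝ) ≠ 0 := by positivity
    unfold phaseErrorRate
    field_simp

lemma phaseErrorRate_nonneg (α : Fin d) : 0 ≤ phaseErrorRate lam α := by
  unfold phaseErrorRate
  positivity

lemma phaseErrorRate_le_one (α : Fin d) : phaseErrorRate lam α ≤ 1 := by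
  unfold phaseErrorRate
  rw [one_div_mul_eq_div]
  exact div_le_one_of_le₀ (by exact_mod_cast phaseErrorCount_le_bitCount lam α) (by positivity)

lemma phaseProb_nonneg (hd : 2 ≤ d) (α β : Fin d) : 0 ≤ phaseProb lam α β := by
  have hd' : (2 : ℝ) ≤ d := by exact_mod_cast hd
  unfold phaseProb
  split_ifs
  · exact div_nonneg (phaseErrorRate_nonneg lam α) (by linarith)
  · linarith [phaseErrorRate_le_one lam α]

lemma filter_one_le_val (hd : 2 ≤ d) :
    (Finset.univ.filter fun β : Fin d => ¬ 1 ≤ β.val) = {⟨0, by omega⟩} := by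
  ext β
  simp [Fin.ext_iff]

lemma sum_phaseProb (hd : 2 ≤ d) (α : Fin d) : ∑ β, phaseProb lam α β = 1 := by
  have hd' : (2 : ℝ) ≤ d := by exact_mod_cast hd
  have hc : (Finset.univ.filter fun β : Fin d => 1 ≤ β.val).card + 1 = d := by
    have h := Finset.card_filter_add_card_filter_not (s := (Finset.univ : Finset (Fin d)))
      (fun β : Fin d => 1 ≤ β.val)
    rwa [filter_one_le_val hd, Finset.card_singleton, Finset.card_univ, Fintype.card_fin] at h
  have hc' : ((Finset.univ.filter fun β : Fin d => 1 ≤ β.val).card : ℝ) = d - 1 := by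
    rw [eq_sub_iff_add_eq]
    exact_mod_cast hc
  unfold phaseProb
  rw [Finset.sum_ite, Finset.sum_const, Finset.sum_const, filter_one_le_val hd,
    Finset.card_singleton, nsmul_eq_mul, nsmul_eq_mul, hc']
  have : (d : ℝ) - 1 ≠ 0 := by linarith
  field_simp
  push_cast
  ring

lemma bitCount_eq (hd : 2 ≤ d) (α : Fin d) :
    phaseErrorCount lam α + lam α ⟨0, by omega⟩ = bitCount lam α := by
  have h := Finset.sum_filter_add_sum_filter_not Finset.univ (fun β : Fin d => 1 ≤ β.val) (lam α)
  rwa [filter_one_le_val hd, Finset.sum_singleton] at h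

lemma lam_eq_zero_of_phaseProb_eq_zero (hd : 2 ≤ d) {α β : Fin d} (h : phaseProb lam α β = 0) :
    lam α β = 0 := by
  have hd' : (2 : ℝ) ≤ d := by exact_mod_cast hd
  have hm := bitCount_mul_phaseErrorRate lam α
  have hb := bitCount_eq lam hd α
  unfold phaseProb at h
  split_ifs at h with hβ
  · have hp : phaseErrorRate lam α = 0 :=
      (div_eq_zero_iff.mp h).resolve_right (by linarith)
    rw [hp, mul_zero] at hm
    have h0 : phaseErrorCount lam α = 0 := by exact_mod_cast hm.symm
    exact Finset.sum_eq_zero_iff.mp h0 β (by simpa using hβ)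
  · have hp : phaseErrorRate lam α = 1 := by linarith
    rw [hp, mul_one] at hm
    have h0 : bitCount lam α = phaseErrorCount lam α := by exact_mod_cast hm
    have : β = ⟨0, by omega⟩ := Fin.ext (by simpa using hβ)
    rw [this]
    omega

lemma sum_lam_mul_logb_phaseProb (hd : 2 ≤ d) (α : Fin d) :
    ∑ β, (lam α β : ℝ) * Real.logb 2 (phaseProb lam α β) =
      -(1 / Real.logb d 2 * ((bitCount lam α : ℝ) * daryEntropy d (phaseErrorRate lam α))) := by
  have hd' : (2 : ℝ) ≤ d := by exact_mod_cast hd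
  have hlogd : Real.log d ≠ 0 := (Real.log_pos (by linarith)).ne'
  have hlog2 : Real.log 2 ≠ 0 := (Real.log_pos (by norm_num)).ne'
  have hm := bitCount_mul_phaseErrorRate lam α
  have hb : (phaseErrorCount lam α : ℝ) + lam α ⟨0, by omega⟩ = bitCount lam α := by
    exact_mod_cast bitCount_eq lam hd α
  set p := phaseErrorRate lam α with hp
  have hsum : ∑ β, (lam α β : ℝ) * Real.logb 2 (phaseProb lam α β) =
      phaseErrorCount lam α * Real.logb 2 (p / (d - 1)) +
        lam α ⟨0, by omega⟩ * Real.logb 2 (1 - p) := by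
    rw [← Finset.sum_filter_add_sum_filter_not Finset.univ (fun β : Fin d => 1 ≤ β.val),
      filter_one_le_val hd, Finset.sum_singleton]
    congr 1
    rw [phaseErrorCount, Nat.cast_sum, Finset.sum_mul]
    refine Finset.sum_congr rfl fun β hβ => ?_
    rw [phaseProb, if_pos (by simpa using hβ)]
  -- For `p = 0` both sides vanish: there is no nonzero phase, whatever the value of `log 0`.
  have hquot : (phaseErrorCount lam α : ℝ) * Real.log (p / (d - 1)) =
      phaseErrorCount lam α * (Real.log p - Real.log (d - 1)) := by
    rcases eq_or_ne p 0 with h0 | h0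
    · rw [← hm, h0]
      simp
    · rw [Real.log_div h0 (by linarith)]
  have hlam : (lam α ⟨0, by omega⟩ : ℝ) = bitCount lam α * (1 - p) := by linarith
  rw [hsum]
  simp only [Real.logb, daryEntropy]
  rw [← mul_div_assoc, hquot, ← hm, hlam]
  field_simp
  ring

/-- The probability of a phase string that makes up a word of type `lam`. -/
lemma prod_phaseProb_pow (hd : 2 ≤ d) :
    ∏ α, ∏ β, phaseProb lam α β ^ lam α β = (2 : ℝ) ^ (-phaseEntropy lam) := by
  -- A phase of probability `0` has multiplicity `0`, so its factor is `0 ^ 0 = 1`.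
  have hpos : ∀ α β, 0 < phaseProb lam α β ^ lam α β := by
    intro α β
    rcases (phaseProb_nonneg lam hd α β).eq_or_lt with h | h
    · simp [lam_eq_zero_of_phaseProb_eq_zero lam hd h.symm]
    · exact pow_pos h _
  have hpos' : ∀ α, 0 < ∏ β, phaseProb lam α β ^ lam α β :=
    fun α => Finset.prod_pos fun β _ => hpos α β
  have hlog : Real.logb 2 (∏ α, ∏ β, phaseProb lam α β ^ lam α β) = -phaseEntropy lam := by
    rw [Real.logb_prod _ _ fun α _ => (hpos' α).ne', phaseEntropy, Finset.mul_sum,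
      ← Finset.sum_neg_distrib]
    refine Finset.sum_congr rfl fun α _ => ?_
    rw [Real.logb_prod _ _ fun β _ => (hpos α β).ne', ← sum_lam_mul_logb_phaseProb lam hd]
    simp_rw [Real.logb_pow]
  rw [← hlog, Real.rpow_logb (by norm_num) (by norm_num) (Finset.prod_pos fun α _ => hpos' α)]

lemma prod_phaseProb_of_mem_typeClass {n : ℕ} {k : Word d n} (hk : k ∈ typeClass n lam) :
    ∏ j, phaseProb lam (bt k j) (ph k j) = ∏ α, ∏ β, phaseProb lam α β ^ lam α β := by
  have hk' : ∀ α β, typeCount α β k = lam α β := by simpa [typeClass] using hk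
  rw [← Fintype.prod_prod_type' fun α β => phaseProb lam α β ^ lam α β,
    ← Finset.prod_fiberwise Finset.univ (fun j => (bt k j, ph k j))]
  refine Finset.prod_congr rfl fun ab _ => ?_
  rw [← hk' ab.1 ab.2, typeCount, ← Finset.prod_const]
  refine Finset.prod_congr (by ext j; simp [Prod.ext_iff]) fun j hj => ?_
  simp only [Finset.mem_filter, Finset.mem_univ, true_and] at hj
  rw [hj.1, hj.2]

/-- At most `2 ^ phaseEntropy lam` words of type `lam` share a bit string `x`: for phases drawn
independently with the probabilities `phaseProb lam (x j)`, each of them has the probability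
`2 ^ (-phaseEntropy lam)`. -/
lemma card_typeClass_filter_bt_le (hd : 2 ≤ d) {n : ℕ} (x : Dits d n) :
    (((typeClass n lam).filter fun k => bt k = x).card : ℝ) ≤ (2 : ℝ) ^ phaseEntropy lam := by
  have htotal : ∑ y : Dits d n, ∏ j, phaseProb lam (x j) (y j) = 1 := by
    rw [← Fintype.prod_sum]
    simp [sum_phaseProb lam hd]
  set F := (typeClass n lam).filter fun k => bt k = x with hF
  have hinj : Set.InjOn (ph : Word d n → Dits d n) F := by
    intro k hk l hl h
    simp only [hF, Finset.coe_filter, Set.mem_ofPred_eq] at hk hl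
    funext j
    exact Prod.ext (congrFun h j) (congrFun (hk.2.trans hl.2.symm) j)
  have hle : (F.card : ℝ) * (2 : ℝ) ^ (-phaseEntropy lam) ≤ 1 := by
    calc (F.card : ℝ) * (2 : ℝ) ^ (-phaseEntropy lam)
        = ∑ k ∈ F, ∏ j, phaseProb lam (x j) (ph k j) := by
          rw [← nsmul_eq_mul, ← Finset.sum_const]
          refine Finset.sum_congr rfl fun k hk => ?_
          obtain ⟨hk, hx⟩ := Finset.mem_filter.mp hk
          rw [← hx, prod_phaseProb_of_mem_typeClass lam hk, prod_phaseProb_pow lam hd]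
      _ = ∑ y ∈ F.image ph, ∏ j, phaseProb lam (x j) (y j) := 
          (Finset.sum_image (f := fun y : Dits d n => ∏ j, phaseProb lam (x j) (y j)) hinj).symm
      _ ≤ ∑ y : Dits d n, ∏ j, phaseProb lam (x j) (y j) :=
          Finset.sum_le_sum_of_subset_of_nonneg (Finset.subset_univ _) fun y _ _ =>
            Finset.prod_nonneg fun j _ => phaseProb_nonneg lam hd _ _
      _ = 1 := htotal
  rwa [Real.rpow_neg (by norm_num), ← div_eq_mul_inv, div_le_one (by positivity)] at hle

end Count
/-! ### Block-diagonal operators and measured states -/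

section Block
variable {A ε ι : Type*} [DecidableEq A]

/-- The operator `∑_a |a⟩⟨a| ⊗ ∑_{i ∈ s} |u_{a,i}⟩⟨u_{a,i}|`. -/
def blockGram (s : Finset ι) (u : A → ι → ε → ℂ) : Matrix (A × ε) (A × ε) ℂ :=
  Matrix.of fun p q => if p.1 = q.1 then ∑ i ∈ s, u p.1 i p.2 * star (u q.1 i q.2) else 0

lemma isHermitian_blockGram (s : Finset ι) (u : A → ι → ε → ℂ) :
    (blockGram s u).IsHermitian := by
  ext p q
  rw [Matrix.conjTranspose_apply, blockGram, Matrix.of_apply, Matrix.of_apply]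
  by_cases h : p.1 = q.1
  · simp [h, mul_comm]
  · simp [h, Ne.symm h]

lemma star_dotProduct_blockGram_mulVec [Fintype A] [Fintype ε] (s : Finset ι)
    (u : A → ι → ε → ℂ) (z : A × ε → ℂ) :
    star z ⬝ᵥ (blockGram s u).mulVec z =
      ((∑ a, ∑ i ∈ s, ‖∑ e, star (z (a, e)) * u a i e‖ ^ 2 : ℝ) : ℂ) := by
  have key : ∀ z : ℂ, ((‖z‖ ^ 2 : ℝ) : ℂ) = z * star z := fun z => by
    rw [Complex.star_def, Complex.mul_conj, Complex.normSq_eq_norm_sq]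
  simp only [Complex.ofReal_sum, key, dotProduct, Matrix.mulVec, Fintype.sum_prod_type,
    blockGram, Matrix.of_apply, Pi.star_apply, star_sum, Finset.sum_mul_sum]
  refine Finset.sum_congr rfl fun a _ => ?_
  rw [Finset.sum_comm]
  refine Finset.sum_congr rfl fun e _ => ?_
  rw [Finset.sum_eq_single a (fun b _ hb => by simp [Ne.symm hb]) (by simp), Finset.sum_comm,
    Finset.mul_sum]
  refine Finset.sum_congr rfl fun e' _ => ?_
  rw [if_pos rfl, Finset.sum_mul, Finset.mul_sum]
  refine Finset.sum_congr rfl fun i _ => ?_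
  simp only [star_mul', star_star]
  ring

lemma posSemidef_smul_blockGram_sub [Fintype A] [Fintype ε] {κ : Type*} {s : Finset ι}
    {s' : Finset κ} {u : A → ι → ε → ℂ} {v : A → κ → ε → ℂ} {t : ℝ}
    (h : ∀ a (w : ε → ℂ), ∑ i ∈ s', ‖∑ e, w e * v a i e‖ ^ 2 ≤
      t * ∑ i ∈ s, ‖∑ e, w e * u a i e‖ ^ 2) :
    ((t : ℂ) • blockGram s u - blockGram s' v).PosSemidef := by
  refine Matrix.PosSemidef.of_dotProduct_mulVec_nonneg
    (((isHermitian_blockGram s u).smul (by simp [IsSelfAdjoint])).sub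
      (isHermitian_blockGram s' v)) fun z => ?_
  rw [Matrix.sub_mulVec, dotProduct_sub, Matrix.smul_mulVec, dotProduct_smul,
    star_dotProduct_blockGram_mulVec, star_dotProduct_blockGram_mulVec, smul_eq_mul,
    ← Complex.ofReal_mul, ← Complex.ofReal_sub, Complex.zero_le_real, sub_nonneg, Finset.mul_sum]
  exact Finset.sum_le_sum fun a _ => h a fun e => star (z (a, e))

lemma one_kronecker_sum_ketbra (s : Finset ι) (u : ι → ε → ℂ) :
    (1 : Matrix A A ℂ) ⊗ₖ (∑ i ∈ s, ketbra (u i)) = blockGram s fun _ => u := by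
  ext p q
  simp [Matrix.kroneckerMap_apply, blockGram, Matrix.one_apply, ketbra, Matrix.vecMulVec_apply,
    Matrix.sum_apply]

end Block

lemma measureFst_apply {X ε : Type*} [Fintype X] [DecidableEq X] [Fintype ε] [DecidableEq ε]
    (ρ : Matrix (X × ε) (X × ε) ℂ) (p q : X × ε) :
    measureFst ρ p q = if p.1 = q.1 then ρ p q else 0 := by
  have hdiag : ∀ x : X, Matrix.single x x (1 : ℂ) ⊗ₖ (1 : Matrix ε ε ℂ) =
      Matrix.diagonal fun p : X × ε => if p.1 = x then 1 else 0 := by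
    intro x
    rw [← Matrix.diagonal_single, ← Matrix.diagonal_one, Matrix.diagonal_kronecker_diagonal]
    simp [Pi.single_apply]
  simp only [measureFst, hdiag, Matrix.sum_apply, Matrix.mul_diagonal, Matrix.diagonal_mul]
  rw [Finset.sum_eq_single p.1 (fun x _ hx => by simp [Ne.symm hx]) (by simp)]
  simp [eq_comm]

lemma traceB_measureFst_ketbra {A B ε : Type*} [Fintype A] [DecidableEq A] [Fintype B]
    [DecidableEq B] [Fintype ε] [DecidableEq ε] (ψ : (A × B) × ε → ℂ) :
    traceB (measureFst (ketbra ψ)) =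
      blockGram Finset.univ fun a b e => ψ ((a, b), e) := by
  ext p q
  simp only [traceB, Matrix.of_apply, measureFst_apply, blockGram, ketbra, Matrix.vecMulVec_apply,
    Pi.star_apply, Prod.mk.injEq, and_true]
  split_ifs <;> simp

lemma le_minEntropy {A ε : Type*} [DecidableEq A] [Fintype ε] {ρ : Matrix (A × ε) (A × ε) ℂ}
    {σ : Matrix ε ε ℂ} (hσ : IsDensity σ) {t : ℝ} (ht : 0 < t)
    (h : ((t : ℂ) • ((1 : Matrix A A ℂ) ⊗ₖ σ) - ρ).PosSemidef) :
    ((-Real.logb 2 t : ℝ) : EReal) ≤ minEntropy ρ :=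
  le_iSup₂_of_le σ hσ (le_iSup₂_of_le t ht (le_iSup_of_le h le_rfl))

lemma posSemidef_ketbra {X : Type*} [Finite X] (u : X → ℂ) : (ketbra u).PosSemidef :=
  Matrix.posSemidef_vecMulVec_self_star u

lemma trace_ketbra {X : Type*} [Fintype X] (u : X → ℂ) :
    (ketbra u).trace = ((∑ x, ‖u x‖ ^ 2 : ℝ) : ℂ) := by
  simp [ketbra, Matrix.trace, Matrix.vecMulVec_apply, Complex.mul_conj, Complex.normSq_eq_norm_sq]

/-! ### The min-entropy of a superposition of Bell words -/

/-- If at most `M` words of `J` share a bit string, then for fixed outcomes in the register `A` the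
mixture over the outcomes in `B` is dominated by `M / d ^ n` times the mixture of the vectors
`f k`. -/
lemma sum_norm_sum_bellWord_sq_le {d n : ℕ} (hd : d ≠ 0) {J : Finset (Word d n)} {M : ℝ}
    (hM : ∀ x : Dits d n, ((J.filter fun k => bt k = x).card : ℝ) ≤ M) (f : Word d n → ℂ)
    (a : Dits d n) :
    ∑ b, ‖∑ k ∈ J, f k * bellWord k (a, b)‖ ^ 2 ≤ M / (d : ℝ) ^ n * ∑ k ∈ J, ‖f k‖ ^ 2 := by
  have : NeZero d := ⟨hd⟩
  have hfibre : ∀ x : Dits d n, ‖∑ k ∈ J, f k * bellWord k (a, a + x)‖ ^ 2 ≤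
      M / (d : ℝ) ^ n * ∑ k ∈ J with bt k = x, ‖f k‖ ^ 2 := by
    intro x
    -- Only the words with the bit string `x` have a nonzero amplitude at `(a, a + x)`.
    have hzero : ∑ k ∈ J, f k * bellWord k (a, a + x) =
        ∑ k ∈ J with bt k = x, f k * bellWord k (a, a + x) := by
      refine (Finset.sum_filter_of_ne fun k _ hk => ?_).symm
      by_contra hx
      have h := norm_bellWord_sq hd k a (a + x)
      rw [if_neg (fun h => hx (add_left_cancel h).symm)] at h
      exact hk (by simp [norm_eq_zero.mp (pow_eq_zero_iff two_ne_zero |>.mp h)])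
    rw [hzero]
    calc ‖∑ k ∈ J with bt k = x, f k * bellWord k (a, a + x)‖ ^ 2
        ≤ (∑ k ∈ J with bt k = x, ‖f k * bellWord k (a, a + x)‖) ^ 2 := by
          gcongr
          exact norm_sum_le _ _
      _ ≤ ((J.filter fun k => bt k = x).card : ℝ) *
            ∑ k ∈ J with bt k = x, ‖f k * bellWord k (a, a + x)‖ ^ 2 := sq_sum_le_card_mul_sum_sq
      _ = ((J.filter fun k => bt k = x).card : ℝ) *
            (((d : ℝ) ^ n)⁻¹ * ∑ k ∈ J with bt k = x, ‖f k‖ ^ 2) := by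
          congr 1
          rw [Finset.mul_sum]
          refine Finset.sum_congr rfl fun k hk => ?_
          rw [norm_mul, mul_pow, norm_bellWord_sq hd, if_pos (by rw [(Finset.mem_filter.mp hk).2]),
            mul_comm]
      _ ≤ M * (((d : ℝ) ^ n)⁻¹ * ∑ k ∈ J with bt k = x, ‖f k‖ ^ 2) := by
          gcongr
          exact hM x
      _ = _ := by ring
  calc ∑ b, ‖∑ k ∈ J, f k * bellWord k (a, b)‖ ^ 2
      = ∑ x, ‖∑ k ∈ J, f k * bellWord k (a, a + x)‖ ^ 2 :=
        (Fintype.sum_equiv (Equiv.addLeft a) _ _ fun x => rfl).symm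
    _ ≤ ∑ x, M / (d : ℝ) ^ n * ∑ k ∈ J with bt k = x, ‖f k‖ ^ 2 :=
        Finset.sum_le_sum fun x _ => hfibre x
    _ = _ := by rw [← Finset.mul_sum, Finset.sum_fiberwise]

/-- The reduced state of `E` when the word `k ∈ J` is known to an observer who holds the registers
`A` and `B`: the mixture of the unnormalised vectors `c_k |E_k⟩`. -/
def wordMixture {d n : ℕ} {ε : Type*} (J : Finset (Word d n)) (c : Word d n → ℂ)
    (eve : Word d n → ε → ℂ) : Matrix ε ε ℂ :=
  ∑ k ∈ J, ketbra (c k • eve k)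

lemma isDensity_wordMixture {d n : ℕ} (hd : d ≠ 0) {ε : Type*} [Fintype ε]
    {J : Finset (Word d n)} {c : Word d n → ℂ} {eve : Word d n → ε → ℂ}
    (hψ : ∑ p, ‖bellSuperposition J c eve p‖ ^ 2 = 1) : IsDensity (wordMixture J c eve) := by
  refine ⟨Matrix.posSemidef_sum _ fun k _ => posSemidef_ketbra _, ?_⟩
  rw [wordMixture, Matrix.trace_sum]
  simp_rw [trace_ketbra]
  rw [← Complex.ofReal_sum, Finset.sum_comm, ← Complex.ofReal_one, ← hψ,
    Fintype.sum_prod_type_right]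
  congr 1
  refine Finset.sum_congr rfl fun e _ => ?_
  rw [← sum_norm_sum_bellWord_sq hd]
  refine Finset.sum_congr rfl fun ab _ => ?_
  simp only [bellSuperposition, Pi.smul_apply, smul_eq_mul, mul_right_comm]

/-- A superposition of Bell words of which at most `M` share a bit string leaves the min-entropy
`n log₂ d - log₂ M` in the measured register `A`. -/
theorem le_minEntropy_bellSuperposition {d n : ℕ} (hd : d ≠ 0) {ε : Type*} [Fintype ε]
    [DecidableEq ε] {J : Finset (Word d n)} {c : Word d n → ℂ} {eve : Word d n → ε → ℂ}
    (hψ : ∑ p, ‖bellSuperposition J c eve p‖ ^ 2 = 1) {M : ℝ} (hM0 : 0 < M)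
    (hM : ∀ x : Dits d n, ((J.filter fun k => bt k = x).card : ℝ) ≤ M) :
    ((n * Real.logb 2 d - Real.logb 2 M : ℝ) : EReal) ≤
      minEntropy (traceB (measureFst (ketbra (bellSuperposition J c eve)))) := by
  have hd' : (0 : ℝ) < d := by exact_mod_cast Nat.pos_of_ne_zero hd
  have hlog : n * Real.logb 2 d - Real.logb 2 M = -Real.logb 2 (M / (d : ℝ) ^ n) := by
    rw [Real.logb_div hM0.ne' (by positivity), Real.logb_pow]
    ring
  rw [hlog]
  refine le_minEntropy (isDensity_wordMixture hd hψ) (by positivity) ?_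
  rw [traceB_measureFst_ketbra, wordMixture, one_kronecker_sum_ketbra]
  refine posSemidef_smul_blockGram_sub fun a w => ?_
  refine le_trans (le_of_eq ?_) (sum_norm_sum_bellWord_sq_le hd hM _ a)
  refine Finset.sum_congr rfl fun b _ => ?_
  congr 2
  simp only [bellSuperposition, Finset.mul_sum, Finset.sum_mul, Pi.smul_apply, smul_eq_mul]
  rw [Finset.sum_comm]
  refine Finset.sum_congr rfl fun k _ => Finset.sum_congr rfl fun e _ => ?_
  ring

end HDBell

theorem mainTheorem3 (d n : ℕ) (hd : 2 ≤ d) (lam : Fin d → Fin d → ℕ)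
    {ε : Type*} [Fintype ε] [DecidableEq ε]
    (c : HDBell.Word d n → ℂ) (eve : HDBell.Word d n → ε → ℂ)
    (hψ : ∑ p : (HDBell.Dits d n × HDBell.Dits d n) × ε,
      ‖HDBell.bellSuperposition (HDBell.typeClass n lam) c eve p‖ ^ 2 = 1) :
    (((n : ℝ) * Real.logb 2 d - 1 / Real.logb d 2 *
        ∑ α : Fin d, (HDBell.bitCount lam α : ℝ) *
          HDBell.daryEntropy d
            (1 / (HDBell.bitCount lam α : ℝ) * (HDBell.phaseErrorCount lam α : ℝ)) : ℝ) : EReal) ≤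
      HDBell.minEntropy (HDBell.traceB (HDBell.measureFst (HDBell.ketbra
        (HDBell.bellSuperposition (HDBell.typeClass n lam) c eve)))) := by
  have h := HDBell.le_minEntropy_bellSuperposition (by omega) hψ
    (Real.rpow_pos_of_pos two_pos (HDBell.phaseEntropy lam))
    (HDBell.card_typeClass_filter_bt_le lam hd)
  rwa [Real.logb_rpow (by norm_num) (by norm_num)] at h
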